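/- **Language.** Consider the following language for a universe of things, each of which is a set or a function. Variables $X,Y,Z,\dots$ range over sets, $\alpha,\beta,\gamma,\xi,\dots$ over all things, and, for a term $t$, composite variables $f_t,h_t,\dots$ over functions on the set $t$. There are constants $\emptyset$, $\omega$, $1_\emptyset$; a function symbol $t^+=\{t\}$; terms $f(t)$ (for "the $\beta$ with $f:t\mapsto\beta$"); and variables for families of ur-functions $(f_{\{\xi\}})_{\xi\in X}$ (each $f_{\{\xi\}}$ is a function on the singleton $\{\xi\}$), with member terms $f_{\{t\}}$. Atomic formulas are $s=t$, $s\in t$, $f:s\twoheadrightarrow t$ and $f:s\mapsto t$. Formulas are built with the classical connectives, quantifiers over the variables above, the multiple quantifier $(\forall f_{\{\xi\}})_{\xi\in X}$ and the conjunctive operator $\bigwedge_{\xi\in X}F:\xi\mapsto f_{\{\xi\}}(\xi)$. A formula is standard if neither the multiple quantifier nor the conjunctive operator occurs in it. As usual $(\exists f_{\{\xi\}})_{\xi\in X}:=\neg(\forall f_{\{\xi\}})_{\xi\in X}\neg$. **Logic.** $T\Vvdash\varphi$ means that $\varphi$ is derivable from $T$ in classical natural deduction with equality (with introduction and elimination rules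 for quantifiers over each sort of variables; every thing is a set or a function; $f:t\mapsto f(t)$ follows from $\exists!\beta\,(f:t\mapsto\beta)$), extended by the nonstandard rules: 1. introduction of the multiple quantifier by generalization over an arbitrary family of ur-functions indexed in $X$, and its elimination by instantiation with a given such family; 2. from $\forall\xi\in X\,\exists h_{\{\xi\}}\,\Phi(\xi,h_{\{\xi\}})$ infer $(\exists f_{\{\xi\}})_{\xi\in X}\,\forall\xi\in X\,\Phi(\xi,f_{\{\xi\}})$; 3. from $F:\xi\mapsto f_{\{\xi\}}(\xi)$ for arbitrary $\xi\in X$ infer $\bigwedge_{\xi\in X}F:\xi\mapsto f_{\{\xi\}}(\xi)$; 4. from $\bigwedge_{\xi\in X}F:\xi\mapsto f_{\{\xi\}}(\xi)$ and $s\in X$ infer $F:s\mapsto f_{\{s\}}(s)$. A theory $T$ is consistent if $T\not\Vvdash\bot$. **Axioms.** The standard axioms are: - $\forall X\forall Y(X=Y\Leftrightarrow\forall\alpha(\alpha\in X\Leftrightarrow\alpha\in Y))$ - $\forall X\forall f_X\forall Y(f_X\ne Y)$ - $\forall X\forall\alpha\forall\beta(\neg\,X:\alpha\twoheadrightarrow\beta\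 \wedge\ \neg\,X:\alpha\mapsto\beta)$ - $\exists X(X=\emptyset\wedge\forall\alpha(\alpha\notin X))$ - $\forall\alpha\forall\beta\exists X\forall\gamma(\gamma\in X\Leftrightarrow\gamma=\alpha\vee\gamma=\beta)$ - $\forall X\exists Y\forall\alpha(\alpha\in Y\Leftrightarrow\exists Z(Z\in X\wedge\alpha\in Z))$ - $\forall X\exists Y\forall\alpha(\alpha\in Y\Leftrightarrow\exists Z(Z\subseteq X\wedge\alpha=Z))$ - $\forall X\ne\emptyset\,\exists\alpha(\alpha\in X\wedge\forall\beta(\beta\in\alpha\Rightarrow\beta\notin X))$ - $\exists X(X=\omega\wedge\emptyset\in\omega\wedge\forall\alpha(\alpha\in\omega\Rightarrow\alpha^+\in\omega)\wedge\forall\beta\in\omega(\neg\exists\gamma\in\omega(\beta=\gamma^+)\Leftrightarrow\beta=\emptyset))$ - $\forall\alpha\forall\beta(\beta=\alpha^+\Leftrightarrow\exists X(\beta=X\wedge\forall\gamma(\gamma\in X\Leftrightarrow\gamma=\alpha)))$ - $\forall X\forall f_X\forall\alpha(\alpha\notin f_X)$ - $\forall X\forall f_X(X\ne\emptyset\Rightarrow\exists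 Y\exists Z(f_X:Y\twoheadrightarrow Z\wedge\forall\alpha\in Y\exists!\beta(f_X:\alpha\mapsto\beta)))$ - $\forall X\forall f_X\forall\alpha(\alpha\ne X\Rightarrow\forall\xi\,\neg(f_X:\alpha\twoheadrightarrow\xi))$ - $\forall X\forall f_X\forall\alpha\notin X\,\forall\beta\,\neg(f_X:\alpha\mapsto\beta)$ - $\forall X\forall f_X(X\ne\emptyset\Rightarrow\forall\beta(f_X:X\twoheadrightarrow\beta\Rightarrow\exists Z(\beta=Z\wedge\forall\gamma(\gamma\in Z\Leftrightarrow\exists\eta\in X(f_X:\eta\mapsto\gamma)))))$ - $\forall X\ne\emptyset\,\forall f_X\forall Y(f_X:X\twoheadrightarrow Y\Rightarrow\forall\beta\exists Z\forall\alpha(\alpha\in Z\Leftrightarrow\alpha\in X\wedge f_X:\alpha\mapsto\beta))$ - $\exists f_\emptyset(f_\emptyset=1_\emptyset\wedge f_\emptyset:\emptyset\twoheadrightarrow\emptyset\wedge\forall\alpha\forall\beta\,\neg(f_\emptyset:\alpha\mapsto\beta))$ - $\forall\alpha\forall\beta\exists f_{\alpha^+}(f_{\alpha^+}:\alpha^+\twoheadrightarrow\beta^+\wedge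 f_{\alpha^+}:\alpha\mapsto\beta)$ - $\forall X\forall f_X\forall Y(f_X:X\twoheadrightarrow Y\Rightarrow\forall\alpha(\neg(f_X:f_X\mapsto\alpha)\wedge\neg(f_X:\alpha\mapsto f_X)))$ The theory $\mathfrak T^\infty_0$ consists of the standard axioms, all instances for standard formulas $\Phi,\Psi$ (with parameters) of $$\forall X\exists Y\forall\alpha(\alpha\in Y\Leftrightarrow\alpha\in X\wedge\Phi(\alpha)),$$ $$\forall X\big(\forall\alpha\in X\,\exists!\beta\,\Psi(\alpha,\beta)\Rightarrow\exists Z\forall\gamma(\gamma\in Z\Leftrightarrow\exists\xi(\xi\in X\wedge\Psi(\xi,\gamma)))\big),$$ and the reverse-graph axiom $$\forall f\forall X\forall Y\big(f\in Y^X\Rightarrow\exists h_X\forall\alpha\forall\beta(h_X:\alpha\mapsto\beta\Leftrightarrow(\alpha,\beta)\in f)\big),$$ where $f$ ranges over sets, $(\alpha,\beta)=\{\alpha,\{\alpha,\beta\}\}$, and $f\in Y^X$ says that the set $f$ is the graph of a function from $X$ to $Y$. The Sum Function Axiom is $$\text{SUM-F}:\quad\forall X(\forall f_{\{\xi\}})_{\xi\in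 X}\exists F_X\exists Y\Big[F_X:X\twoheadrightarrow Y\wedge\bigwedge_{\xi\in X}F_X:\xi\mapsto f_{\{\xi\}}(\xi)\Big].$$ $\mathfrak T$ is the theory given by the standard axioms and SUM-F. **Proposition.** The negation of SUM-F cannot be derived from $\mathfrak T^\infty_0$: $$\mathfrak T^\infty_0\not\Vvdash\neg\,\text{SUM-F}.$$ Moreover, if $\mathfrak T^\infty_0$ is consistent (in the sense of $\Vvdash$), then so are $\mathfrak T^\infty_0\cup\{\text{SUM-F}\}$ and $\mathfrak T$. -/

import Mathlib

/-!  The language, the calculus and the postulates of a theory of sets and functions with a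
multiple quantifier and a conjunctive operator.

Bound variables are represented by de Bruijn indices.  There are two kinds of variables:

* thing variables `Term.var n` (sets, functions, arbitrary things; which of these is meant is
  determined by the quantifier that binds the variable);
* family variables, numbered by natural numbers `k`; a family variable stands for a family of
  ur-functions `(f_{ξ})_{ξ ∈ X}`, and `Term.fam k t` is its member `f_{t}` on the singleton of `t`.

The constants for individual sets, functions and families that occur in informal derivations
are the free variables of the calculus below.
-/

namespace FunSet

/-- Terms. -/
inductive Term : Type
  /-- A thing variable. -/
  | var (n : ℕ)
  /-- The empty set. -/
  | empty
  /-- The set of all finite Zermelo ordinals. -/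
  | omega
  /-- The inactive function `1_∅`. -/
  | inactive
  /-- `t⁺ = {t}`, the singleton of `t` (its Zermelo successor). -/
  | succ (t : Term)
  /-- The member `f_{t}` of the `k`-th family of ur-functions. -/
  | fam (k : ℕ) (t : Term)
  /-- `f(t)`, the thing `β` with `f : t ↦ β`. -/
  | val (f t : Term)

/-- Formulas. Negation, conjunction etc. are defined from `bot` and `imp` below. -/
inductive Formula : Type
  /-- `s = t`. -/
  | eq (s t : Term)
  /-- `s ∈ t`. -/
  | mem (s t : Term)
  /-- `f : s ↠ t`. -/
  | surj (f s t : Term)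
  /-- `f : s ↦ t`. -/
  | maps (f s t : Term)
  | bot
  | imp (φ ψ : Formula)
  /-- `∀ α, φ`, with `α` ranging over all things. -/
  | all (φ : Formula)
  /-- `∀ X, φ`, with `X` ranging over sets. -/
  | allSet (φ : Formula)
  /-- `∀ f_t, φ`, with `f_t` ranging over the functions on the set `t`
  (the bound variable does not occur in `t`). -/
  | allFun (t : Term) (φ : Formula)
  /-- The multiple quantifier `(∀ f_{ξ})_{ξ ∈ t} φ`; it binds a family variable. -/
  | allFam (t : Term) (φ : Formula)
  /-- The conjunctive operator `⋀_{ξ ∈ t} F : ξ ↦ f_{ξ}(ξ)`, for the `k`-th family. -/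
  | bigAnd (t F : Term) (k : ℕ)

namespace Term

/-- Simultaneous substitution of terms for thing variables and of family variables for family
variables. -/
def subst (σ : ℕ → Term) (ρ : ℕ → ℕ) : Term → Term
  | var n => σ n
  | empty => empty
  | omega => omega
  | inactive => inactive
  | succ t => succ (t.subst σ ρ)
  | fam k t => fam (ρ k) (t.subst σ ρ)
  | val f t => val (f.subst σ ρ) (t.subst σ ρ)

/-- Pass below a binder of a thing variable. -/
def shift (t : Term) : Term := t.subst (fun n => var (n + 1)) id

/-- Pass below a binder of a family variable. -/
def shiftFam (t : Term) : Term := t.subst var Nat.succ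

end Term

open Term (var empty omega inactive succ fam val)

/-- The sequence `a, s 0, s 1, …`. -/
def scons {α : Type} (a : α) (s : ℕ → α) : ℕ → α
  | 0 => a
  | n + 1 => s n

/-- A substitution, below a binder of a thing variable. -/
def up (σ : ℕ → Term) : ℕ → Term
  | 0 => var 0
  | n + 1 => (σ n).shift

/-- A renaming of family variables, below a binder of a family variable. -/
def upFam (ρ : ℕ → ℕ) : ℕ → ℕ
  | 0 => 0
  | k + 1 => ρ k + 1

namespace Formula

/-- Simultaneous (capture-avoiding) substitution in a formula. -/
def subst : Formula → (ℕ → Term) → (ℕ → ℕ) → Formula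
  | eq s t, σ, ρ => eq (s.subst σ ρ) (t.subst σ ρ)
  | mem s t, σ, ρ => mem (s.subst σ ρ) (t.subst σ ρ)
  | surj f s t, σ, ρ => surj (f.subst σ ρ) (s.subst σ ρ) (t.subst σ ρ)
  | maps f s t, σ, ρ => maps (f.subst σ ρ) (s.subst σ ρ) (t.subst σ ρ)
  | bot, _, _ => bot
  | imp φ ψ, σ, ρ => imp (φ.subst σ ρ) (ψ.subst σ ρ)
  | all φ, σ, ρ => all (φ.subst (up σ) ρ)
  | allSet φ, σ, ρ => allSet (φ.subst (up σ) ρ)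
  | allFun t φ, σ, ρ => allFun (t.subst σ ρ) (φ.subst (up σ) ρ)
  | allFam t φ, σ, ρ =>
      allFam (t.subst σ ρ) (φ.subst (fun n => (σ n).shiftFam) (upFam ρ))
  | bigAnd t F k, σ, ρ => bigAnd (t.subst σ ρ) (F.subst σ ρ) (ρ k)

/-- Pass below a binder of a thing variable. -/
def shift (φ : Formula) : Formula := φ.subst (fun n => var (n + 1)) id

/-- Pass below a binder of a family variable. -/
def shiftFam (φ : Formula) : Formula := φ.subst var Nat.succ

/-- Replace the outermost thing variable (index `0`) by the term `t`. -/
def inst (φ : Formula) (t : Term) : Formula :=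
  φ.subst (scons t var) id

/-- Replace the outermost family variable (index `0`) by the family variable `k`. -/
def instFam (φ : Formula) (k : ℕ) : Formula :=
  φ.subst var (scons k id)

/-- Negation. -/
def neg (φ : Formula) : Formula := φ.imp bot
/-- Conjunction. -/
def and (φ ψ : Formula) : Formula := (φ.imp ψ.neg).neg
/-- Disjunction. -/
def or (φ ψ : Formula) : Formula := φ.neg.imp ψ
/-- Equivalence. -/
def iff (φ ψ : Formula) : Formula := (φ.imp ψ).and (ψ.imp φ)
/-- `∃ α, φ`. -/
def ex (φ : Formula) : Formula := φ.neg.all.neg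
/-- `∃ X, φ`. -/
def exSet (φ : Formula) : Formula := φ.neg.allSet.neg
/-- `∃ f_t, φ`. -/
def exFun (t : Term) (φ : Formula) : Formula := (allFun t φ.neg).neg
/-- `(∃ f_{ξ})_{ξ ∈ t} φ`. -/
def exFam (t : Term) (φ : Formula) : Formula := (allFam t φ.neg).neg
/-- `∃! α, φ`, that is, `∃ α, φ(α) ∧ ∀ β, φ(β) → β = α`. -/
def exUnique (φ : Formula) : Formula :=
  ex (φ.and (all
    ((φ.subst (scons (var 0) fun n => var (n + 2)) id).imp
      (eq (var 0) (var 1)))))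
/-- `∀ α ∈ t, φ` (the bound variable does not occur in `t`). -/
def allIn (t : Term) (φ : Formula) : Formula := all ((mem (var 0) t.shift).imp φ)
/-- `∃ α ∈ t, φ`. -/
def exIn (t : Term) (φ : Formula) : Formula := ex ((mem (var 0) t.shift).and φ)

/-- `t` is a set: `∃ X, X = t`. -/
def isSet (t : Term) : Formula := exSet (eq (var 0) t.shift)
/-- `g` is a function on `t`: `∃ f_t, f_t = g`. -/
def isFun (t g : Term) : Formula := exFun t (eq (var 0) g.shift)
/-- The `k`-th family is a family of ur-functions indexed in `t`: for every `ξ ∈ t`, its member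
`f_{ξ}` is a function on `{ξ}`. -/
def isFam (t : Term) (k : ℕ) : Formula :=
  allIn t (isFun (succ (var 0)) (fam k (var 0)))

/-- The standard formulas: no multiple quantifier and no conjunctive operator occurs. -/
def IsStandard : Formula → Prop
  | eq _ _ => True
  | mem _ _ => True
  | surj _ _ _ => True
  | maps _ _ _ => True
  | bot => True
  | imp φ ψ => φ.IsStandard ∧ ψ.IsStandard
  | all φ => φ.IsStandard
  | allSet φ => φ.IsStandard
  | allFun _ φ => φ.IsStandard
  | allFam _ _ => False
  | bigAnd _ _ _ => False

end Formula

open Formula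

/-- `Derives T Γ φ`: in the nonstandard logic, `φ` is derivable from the postulates in `T`, under
the hypotheses `Γ`. Free variables in members of `T` may be taken arbitrarily (a theory consists
of sentences and of schemata that are closed under substitution), free variables in `Γ` are
parameters. The calculus is classical natural deduction with equality, with a quantifier for
every sort of variables, and with the nonstandard rules at the end. -/
inductive Derives (T : Set Formula) : List Formula → Formula → Prop
  | ax {Γ φ} : φ ∈ T → Derives T Γ φ
  | hyp {Γ φ} : φ ∈ Γ → Derives T Γ φ
  | impI {Γ φ ψ} : Derives T (φ :: Γ) ψ → Derives T Γ (φ.imp ψ)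
  | impE {Γ φ ψ} : Derives T Γ (φ.imp ψ) → Derives T Γ φ → Derives T Γ ψ
  | raa {Γ φ} : Derives T (φ.neg :: Γ) bot → Derives T Γ φ
  | eqI {Γ} (t : Term) : Derives T Γ (eq t t)
  | eqE {Γ} (φ : Formula) (s t : Term) :
      Derives T Γ (eq s t) → Derives T Γ (φ.inst s) → Derives T Γ (φ.inst t)
  | allI {Γ φ} : Derives T (Γ.map shift) φ → Derives T Γ (all φ)
  | allE {Γ φ} (t : Term) : Derives T Γ (all φ) → Derives T Γ (φ.inst t)
  | allSetI {Γ φ} :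
      Derives T (isSet (var 0) :: Γ.map shift) φ → Derives T Γ (allSet φ)
  | allSetE {Γ φ} (t : Term) :
      Derives T Γ (allSet φ) → Derives T Γ (isSet t) → Derives T Γ (φ.inst t)
  | allFunI {Γ t φ} :
      Derives T (isFun t.shift (var 0) :: Γ.map shift) φ → Derives T Γ (allFun t φ)
  | allFunE {Γ t φ} (g : Term) :
      Derives T Γ (allFun t φ) → Derives T Γ (isFun t g) → Derives T Γ (φ.inst g)
  /-- All things are sets or functions. -/
  | thing {Γ} (t : Term) :
      Derives T Γ ((isSet t).or (exSet (isFun (var 0) t.shift)))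
  /-- `f(t)` denotes the unique `β` with `f : t ↦ β`, if there is one. -/
  | valI {Γ} (f t : Term) :
      Derives T Γ (exUnique (maps f.shift t.shift (var 0))) →
      Derives T Γ (maps f t (val f t))
  /-- Introduction of the multiple quantifier. -/
  | allFamI {Γ t φ} :
      Derives T (isFam t.shiftFam 0 :: Γ.map shiftFam) φ → Derives T Γ (allFam t φ)
  /-- Elimination of the multiple quantifier, for a given family. -/
  | allFamE {Γ t φ} (k : ℕ) :
      Derives T Γ (allFam t φ) → Derives T Γ (isFam t k) → Derives T Γ (φ.instFam k)
  /-- Formation of a family: if for every `ξ ∈ t` there is an ur-function `h_{ξ}` with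
  `φ(ξ, h_{ξ})`, then there is a family `(f_{ξ})_{ξ ∈ t}` with `φ(ξ, f_{ξ})` for all `ξ ∈ t`.
  In `φ`, index `0` is `h_{ξ}` and index `1` is `ξ`. -/
  | exFamI {Γ} (t : Term) (φ : Formula) :
      Derives T Γ (allIn t (exFun (succ (var 0)) φ)) →
      Derives T Γ (exFam t (allIn t.shiftFam
        (φ.subst (scons (fam 0 (var 0)) var) Nat.succ)))
  /-- Introduction of the conjunctive operator, from the formulas `F : ξ ↦ f_{ξ}(ξ)` for
  arbitrary `ξ ∈ t`. -/
  | bigAndI {Γ} (t F : Term) (k : ℕ) :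
      Derives T (mem (var 0) t.shift :: Γ.map shift)
        (maps F.shift (var 0) (val (fam k (var 0)) (var 0))) →
      Derives T Γ (bigAnd t F k)
  /-- Elimination of the conjunctive operator. -/
  | bigAndE {Γ} (t F : Term) (k : ℕ) (s : Term) :
      Derives T Γ (bigAnd t F k) → Derives T Γ (mem s t) →
      Derives T Γ (maps F s (val (fam k s) s))

/-- `T ⊩ φ`: derivability in the nonstandard logic. -/
def Entails (T : Set Formula) (φ : Formula) : Prop := Derives T [] φ

/-- Consistency in the nonstandard logic. -/
def Consistent (T : Set Formula) : Prop := ¬ Entails T bot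

/-! The set-theoretical postulates. -/

/-- `∀ X ∀ Y (X = Y ⇔ ∀ α (α ∈ X ⇔ α ∈ Y))` -/
def extensionality : Formula :=
  allSet (allSet ((eq (var 1) (var 0)).iff
    (all ((mem (var 0) (var 2)).iff (mem (var 0) (var 1))))))

/-- `∀ X ∀ f_X ∀ Y (f_X ≠ Y)` -/
def functionsNotSets : Formula :=
  allSet (allFun (var 0) (allSet (eq (var 1) (var 0)).neg))

/-- `∀ X ∀ α ∀ β (¬ X : α ↠ β ∧ ¬ X : α ↦ β)` -/
def setsInactive : Formula :=
  allSet (all (all ((surj (var 2) (var 1) (var 0)).neg.and (maps (var 2) (var 1) (var 0)).neg)))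

/-- `∃ X (X = ∅ ∧ ∀ α (α ∉ X))` -/
def emptySet : Formula :=
  exSet ((eq (var 0) empty).and (all (mem (var 0) (var 1)).neg))

/-- `∀ α ∀ β ∃ X ∀ γ (γ ∈ X ⇔ γ = α ∨ γ = β)` -/
def pairing : Formula :=
  all (all (exSet (all ((mem (var 0) (var 1)).iff
    ((eq (var 0) (var 3)).or (eq (var 0) (var 2)))))))

/-- `∀ X ∃ Y ∀ α (α ∈ Y ⇔ ∃ Z (Z ∈ X ∧ α ∈ Z))` -/
def unionSet : Formula :=
  allSet (exSet (all ((mem (var 0) (var 1)).iff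
    (exSet ((mem (var 0) (var 3)).and (mem (var 1) (var 0)))))))

/-- `∀ X ∃ Y ∀ α (α ∈ Y ⇔ ∃ Z (Z ⊆ X ∧ α = Z))` -/
def powerSet : Formula :=
  allSet (exSet (all ((mem (var 0) (var 1)).iff
    (exSet ((allIn (var 0) (mem (var 0) (var 4))).and (eq (var 1) (var 0)))))))

/-- `∀ X ≠ ∅ ∃ α (α ∈ X ∧ ∀ β (β ∈ α ⇒ β ∉ X))` -/
def regularity : Formula :=
  allSet ((eq (var 0) empty).neg.imp
    (ex ((mem (var 0) (var 1)).and (all ((mem (var 0) (var 1)).imp (mem (var 0) (var 2)).neg)))))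

/-- `∃ X (X = ω ∧ ∅ ∈ ω ∧ ∀ α (α ∈ ω ⇒ α⁺ ∈ ω) ∧ ∀ β ∈ ω (¬ ∃ γ ∈ ω (β = γ⁺) ⇔ β = ∅))` -/
def infiniteSet : Formula :=
  exSet ((eq (var 0) omega).and ((mem empty omega).and
    ((all ((mem (var 0) omega).imp (mem (succ (var 0)) omega))).and
      (allIn omega ((exIn omega (eq (var 1) (succ (var 0)))).neg.iff (eq (var 0) empty))))))

/-- `∀ α ∀ β (β = α⁺ ⇔ ∃ X (β = X ∧ ∀ γ (γ ∈ X ⇔ γ = α)))` -/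
def successor : Formula :=
  all (all ((eq (var 0) (succ (var 1))).iff
    (exSet ((eq (var 1) (var 0)).and
      (all ((mem (var 0) (var 1)).iff (eq (var 0) (var 3))))))))

/-! The standard function-theoretical postulates. -/

/-- `∀ X ∀ f_X ∀ α (α ∉ f_X)` -/
def functionsNoElements : Formula :=
  allSet (allFun (var 0) (all (mem (var 0) (var 1)).neg))

/-- `∀ X ∀ f_X (X ≠ ∅ ⇒ ∃ Y ∃ Z (f_X : Y ↠ Z ∧ ∀ α ∈ Y ∃! β (f_X : α ↦ β)))` -/
def functionsAct : Formula :=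
  allSet (allFun (var 0) ((eq (var 1) empty).neg.imp
    (exSet (exSet ((surj (var 2) (var 1) (var 0)).and
      (allIn (var 1) (exUnique (maps (var 4) (var 1) (var 0)))))))))

/-- `∀ X ∀ f_X ∀ α (α ≠ X ⇒ ∀ ξ (¬ f_X : α ↠ ξ))` -/
def uniqueDomain : Formula :=
  allSet (allFun (var 0) (all ((eq (var 0) (var 2)).neg.imp
    (all (surj (var 2) (var 1) (var 0)).neg))))

/-- `∀ X ∀ f_X ∀ α ∉ X ∀ β (¬ f_X : α ↦ β)` -/
def noActionOutside : Formula :=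
  allSet (allFun (var 0) (all ((mem (var 0) (var 2)).neg.imp
    (all (maps (var 2) (var 1) (var 0)).neg))))

/-- `∀ X ∀ f_X (X ≠ ∅ ⇒ ∀ β (f_X : X ↠ β ⇒
  ∃ Z (β = Z ∧ ∀ γ (γ ∈ Z ⇔ ∃ η ∈ X (f_X : η ↦ γ)))))` -/
def imageSet : Formula :=
  allSet (allFun (var 0) ((eq (var 1) empty).neg.imp
    (all ((surj (var 1) (var 2) (var 0)).imp
      (exSet ((eq (var 1) (var 0)).and
        (all ((mem (var 0) (var 1)).iff
          (exIn (var 4) (maps (var 4) (var 0) (var 1)))))))))))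

/-- `∀ X ≠ ∅ ∀ f_X ∀ Y (f_X : X ↠ Y ⇒ ∀ β ∃ Z ∀ α (α ∈ Z ⇔ α ∈ X ∧ f_X : α ↦ β))` -/
def inverseImageSet : Formula :=
  allSet ((eq (var 0) empty).neg.imp (allFun (var 0) (allSet
    ((surj (var 1) (var 2) (var 0)).imp
      (all (exSet (all ((mem (var 0) (var 1)).iff
        ((mem (var 0) (var 5)).and (maps (var 4) (var 0) (var 2)))))))))))

/-- `∃ f_∅ (f_∅ = 1_∅ ∧ f_∅ : ∅ ↠ ∅ ∧ ∀ α ∀ β (¬ f_∅ : α ↦ β))` -/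
def inactiveFunction : Formula :=
  exFun empty ((eq (var 0) inactive).and ((surj (var 0) empty empty).and
    (all (all (maps (var 2) (var 1) (var 0)).neg))))

/-- `∀ α ∀ β ∃ f_{α⁺} (f_{α⁺} : α⁺ ↠ β⁺ ∧ f_{α⁺} : α ↦ β)` -/
def urFunction : Formula :=
  all (all (exFun (succ (var 1))
    ((surj (var 0) (succ (var 2)) (succ (var 1))).and (maps (var 0) (var 2) (var 1)))))

/-- `∀ X ∀ f_X ∀ Y (f_X : X ↠ Y ⇒ ∀ α (¬ f_X : f_X ↦ α ∧ ¬ f_X : α ↦ f_X))` -/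
def functionRegularity : Formula :=
  allSet (allFun (var 0) (allSet ((surj (var 1) (var 2) (var 0)).imp
    (all ((maps (var 2) (var 2) (var 0)).neg.and (maps (var 2) (var 0) (var 2)).neg)))))

/-- The standard postulates. -/
def basicPostulates : Set Formula :=
  {extensionality, functionsNotSets, setsInactive, emptySet, pairing, unionSet, powerSet,
    regularity, infiniteSet, successor, functionsNoElements, functionsAct, uniqueDomain,
    noActionOutside, imageSet, inverseImageSet, inactiveFunction, urFunction,
    functionRegularity}

/-! The collection `Γ` of standard formulas: separation, replacement, reverse graph. -/

/-- `∀ X ∃ Y ∀ α (α ∈ Y ⇔ α ∈ X ∧ φ(α))`. In `φ`, index `0` is `α`, index `1` is `X`, and the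
other variables are parameters. -/
def separation (φ : Formula) : Formula :=
  allSet (exSet (all ((mem (var 0) (var 1)).iff ((mem (var 0) (var 2)).and
    (φ.subst (scons (var 0) fun n => var (n + 2)) id)))))

/-- `∀ X (∀ α ∈ X ∃! β ψ(α, β) ⇒ ∃ Z ∀ γ (γ ∈ Z ⇔ ∃ ξ (ξ ∈ X ∧ ψ(ξ, γ))))`. In `ψ`, index `0`
is `β`, index `1` is `α`, index `2` is `X`, and the other variables are parameters. -/
def replacement (ψ : Formula) : Formula :=
  allSet ((allIn (var 0) (exUnique ψ)).imp
    (exSet (all ((mem (var 0) (var 1)).iff (exIn (var 2)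
      (ψ.subst (scons (var 1) (scons (var 0) fun n => var (n + 3))) id))))))

/-- `t` is the set `{a, b}`. -/
def isPairSet (t a b : Term) : Formula :=
  (isSet t).and (all ((mem (var 0) t.shift).iff
    ((eq (var 0) a.shift).or (eq (var 0) b.shift))))

/-- `t` is the two-tuple `(a, b) = {a, {a, b}}`. -/
def isTuple (t a b : Term) : Formula :=
  ex ((isPairSet (var 0) a.shift b.shift).and (isPairSet t.shift a.shift (var 0)))

/-- `(a, b) ∈ g`. -/
def tupleMem (a b g : Term) : Formula :=
  exIn g (isTuple (var 0) a.shift b.shift)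

/-- `g ∈ Y ^ X`: the set `g` is the graph of a function from `X` to `Y`, i.e. every element of `g`
is a two-tuple `(α, β)` with `α ∈ X` and `β ∈ Y`, and for every `α ∈ X` there is exactly one `β`
with `(α, β) ∈ g`. -/
def isGraph (g X Y : Term) : Formula :=
  (isSet g).and
    ((allIn g (exIn X.shift (exIn Y.shift.shift (isTuple (var 2) (var 1) (var 0))))).and
      (allIn X (exUnique (tupleMem (var 1) (var 0) g.shift.shift))))

/-- `∀ f ∀ X ∀ Y (f ∈ Y ^ X ⇒ ∃ h_X ∀ α ∀ β (h_X : α ↦ β ⇔ (α, β) ∈ f))` -/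
def reverseGraph : Formula :=
  allSet (allSet (allSet ((isGraph (var 2) (var 1) (var 0)).imp
    (exFun (var 1) (all (all
      ((maps (var 2) (var 1) (var 0)).iff (tupleMem (var 1) (var 0) (var 5)))))))))

/-- The theory `𝔗^∞_0`: the standard postulates, all instances of separation and replacement for
standard formulas, and reverse graph. -/
def theoryT0 : Set Formula :=
  basicPostulates ∪ {χ | ∃ φ : Formula, φ.IsStandard ∧ χ = separation φ} ∪
    {χ | ∃ ψ : Formula, ψ.IsStandard ∧ χ = replacement ψ} ∪ {reverseGraph}

/-- The sum function postulate
`∀ X (∀ f_{ξ})_{ξ ∈ X} ∃ F_X ∃ Y [F_X : X ↠ Y ∧ ⋀_{ξ ∈ X} F_X : ξ ↦ f_{ξ}(ξ)]`. -/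
def sumF : Formula :=
  allSet (allFam (var 0) (exFun (var 0) (exSet
    ((surj (var 1) (var 2) (var 0)).and (bigAnd (var 2) (var 1) 0)))))

/-- The theory `𝔗`: the standard postulates and the sum function postulate. -/
def theoryT : Set Formula := basicPostulates ∪ {sumF}

end FunSet

namespace FunSet

/-! ### A universe of sets and functions

Inside `ZFSet`, a set of things is coded by `(∅, u)`, where `u` consists of codes, and a function
is coded by `({∅}, g)`, where `g` contains the pairs of an argument and its value. -/

/-! The proof is semantic: there is a universe in which every postulate of `theoryT0` and SUM-F are
true, and the calculus preserves truth in it. So neither `bot` nor the negation of SUM-F is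
derivable from these postulates.

The universe consists of hereditarily tagged codes in `ZFSet.{0}`, the tag separating sets from
functions. Sets are extensional. Functions need not be: the code of a function may be multivalued,
and `app` chooses one value at each argument. The chosen value is the one that counts in `Maps` and
`Surj`. Ranks of codes are well-founded, which gives regularity for sets and for functions. Any
`Small.{0}` collection of things is the extension of a set (`mkSet`), and any map on it is the
action of a function (`mkFn`). Separation, replacement and power set follow for arbitrary Lean
predicates, in particular for those that formulas define.

A family variable is interpreted as any map from things to things, the multiple quantifier ranges
over those maps that yield ur-functions on the index set, and the conjunctive operator becomes a
universal statement. Rule 2 is then the axiom of choice of the metatheory (`Derives.sat`), and SUM-F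
says that `ξ ↦ f_{ξ}(ξ)` on a small domain is given by a single function (`valid_sumF`). -/

/-- The codes of sets and functions. -/
inductive IsThing : ZFSet.{0} → Prop
  | set (u : ZFSet) : (∀ y ∈ u, IsThing y) → IsThing (ZFSet.pair ∅ u)
  | fn (g : ZFSet) : (∀ a b, ZFSet.pair a b ∈ g → IsThing a) →
      (∀ a b, ZFSet.pair a b ∈ g → IsThing b) → IsThing (ZFSet.pair {∅} g)

/-- The universe of sets and functions. -/
def Thing : Type 1 := {z : ZFSet.{0} // IsThing z}

namespace Thing

/-- `x` is a set. -/
def IsSet (x : Thing) : Prop := ∃ u, x.1 = ZFSet.pair ∅ u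

/-- `x` is a function. -/
def IsFn (x : Thing) : Prop := ∃ g, x.1 = ZFSet.pair {∅} g

/-- The elements of `x`. -/
def ext (x : Thing) : Set Thing := {y | ∃ u, x.1 = ZFSet.pair ∅ u ∧ y.1 ∈ u}

/-- `f` sends `a` to `b` according to the code of `f`. -/
def Sends (f a b : Thing) : Prop := ∃ g, f.1 = ZFSet.pair {∅} g ∧ ZFSet.pair a.1 b.1 ∈ g

/-- The domain of `f`. -/
def dom (f : Thing) : Set Thing := {a | ∃ b, f.Sends a b}

open Classical in
/-- The value of `f` at `a`. -/
noncomputable def app (f a : Thing) : Thing :=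
  if h : ∃ b, f.Sends a b then h.choose else f

theorem sends_app {f a : Thing} (h : a ∈ f.dom) : f.Sends a (f.app a) := by
  have h' : ∃ b, f.Sends a b := h
  rw [app, dif_pos h']
  exact h'.choose_spec

/-- The two tags differ; this is what keeps sets and functions apart. -/
theorem empty_ne_singleton : (∅ : ZFSet.{0}) ≠ {∅} := fun h => by
  have : (∅ : ZFSet.{0}) ∈ ({∅} : ZFSet.{0}) := ZFSet.mem_singleton.2 rfl
  rw [← h] at this
  exact ZFSet.notMem_empty _ this

theorem isSet_or_isFn (x : Thing) : x.IsSet ∨ x.IsFn := by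
  obtain ⟨z, h⟩ := x
  cases h with
  | set u => exact Or.inl ⟨u, rfl⟩
  | fn g => exact Or.inr ⟨g, rfl⟩

theorem IsFn.not_isSet {x : Thing} (h : x.IsFn) : ¬ x.IsSet := by
  rintro ⟨u, hu⟩
  obtain ⟨g, hg⟩ := h
  exact empty_ne_singleton (ZFSet.pair_injective (hu.symm.trans hg)).1

theorem IsFn.ext_eq {x : Thing} (h : x.IsFn) : x.ext = ∅ :=
  Set.eq_empty_of_forall_notMem fun _ ⟨u, hu, _⟩ => h.not_isSet ⟨u, hu⟩

theorem isSet_of_mem {x y : Thing} (h : y ∈ x.ext) : x.IsSet :=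
  let ⟨u, hu, _⟩ := h; ⟨u, hu⟩

theorem isFn_of_mem_dom {f a : Thing} (h : a ∈ f.dom) : f.IsFn :=
  let ⟨_, g, hg, _⟩ := h; ⟨g, hg⟩

/-- The extension contains only those members of the coded set that are things. Since codes are
hereditary, all members are, so the extension determines the code. -/
theorem IsSet.ext_injective {x y : Thing} (hx : x.IsSet) (hy : y.IsSet) (h : x.ext = y.ext) :
    x = y := by
  have key : ∀ {x y : Thing} {u v : ZFSet}, x.1 = ZFSet.pair ∅ u → y.1 = ZFSet.pair ∅ v →
      x.ext = y.ext → ∀ z ∈ u, z ∈ v := by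
    intro x y u v hu hv h z hz
    have hz' : IsThing z := by
      obtain ⟨x, hx⟩ := x
      cases hx with
      | set u' h' =>
        obtain rfl := (ZFSet.pair_injective hu).2
        exact h' z hz
      | fn g => exact (empty_ne_singleton (ZFSet.pair_injective hu).1.symm).elim
    have : (⟨z, hz'⟩ : Thing) ∈ y.ext := h ▸ ⟨u, hu, hz⟩
    obtain ⟨v', hv', hz⟩ := this
    obtain rfl := (ZFSet.pair_injective (hv.symm.trans hv')).2
    exact hz
  obtain ⟨u, hu⟩ := hx
  obtain ⟨v, hv⟩ := hy
  apply Subtype.ext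
  rw [hu, hv]
  congr 1
  exact ZFSet.ext fun z => ⟨key hu hv h z, key hv hu h.symm z⟩

/-! ### Ranks of codes and regularity. -/

theorem rank_left_lt_pair (a b : ZFSet.{0}) : a.rank < (ZFSet.pair a b).rank :=
  (ZFSet.rank_lt_of_mem (ZFSet.mem_singleton.2 rfl)).trans
    (ZFSet.rank_lt_of_mem (ZFSet.mem_pair.2 (Or.inl rfl)))

theorem rank_right_lt_pair (a b : ZFSet.{0}) : b.rank < (ZFSet.pair a b).rank :=
  (ZFSet.rank_lt_of_mem (ZFSet.mem_pair.2 (Or.inr rfl))).trans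
    (ZFSet.rank_lt_of_mem (ZFSet.mem_pair.2 (Or.inr rfl)))

/-- The rank of the code of a thing. -/
noncomputable def rank (x : Thing) : Ordinal.{0} := x.1.rank

theorem rank_lt_of_mem_ext {x y : Thing} (h : y ∈ x.ext) : y.rank < x.rank := by
  obtain ⟨u, hu, hy⟩ := h
  rw [rank, rank, hu]
  exact (ZFSet.rank_lt_of_mem hy).trans (rank_right_lt_pair _ _)

theorem Sends.rank_pair_lt {f a b : Thing} (h : f.Sends a b) :
    (ZFSet.pair a.1 b.1).rank < f.rank := by
  obtain ⟨g, hg, hy⟩ := h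
  rw [rank, hg]
  exact (ZFSet.rank_lt_of_mem hy).trans (rank_right_lt_pair _ _)

/-- An argument of `f` is a component of a pair inside the code of `f`, hence has smaller rank; the
same holds for values. -/
theorem notMem_dom_self (f : Thing) : f ∉ f.dom := fun ⟨_, h⟩ =>
  lt_irrefl _ ((rank_left_lt_pair _ _).trans h.rank_pair_lt)

theorem app_ne_self {f a : Thing} (h : a ∈ f.dom) : f.app a ≠ f := fun e =>
  absurd ((rank_right_lt_pair _ _).trans (sends_app h).rank_pair_lt) (by rw [e]; exact lt_irrefl _)

theorem exists_minimal_mem {x : Thing} (h : x.ext.Nonempty) :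
    ∃ y ∈ x.ext, ∀ z ∈ y.ext, z ∉ x.ext := by
  obtain ⟨y, hy, hmin⟩ := WellFounded.has_min (InvImage.wf rank wellFounded_lt) x.ext h
  exact ⟨y, hy, fun z hz hzx => hmin z hzx (rank_lt_of_mem_ext hz)⟩

/-- The universe lives in `Type 1`, but an extension injects into a single `ZFSet.{0}`. This
licenses `mkSet` and `mkFn` on extensions and on their images and subsets. -/
instance small_ext (x : Thing) : Small.{0} x.ext := by
  obtain ⟨z, h⟩ := x
  cases h with
  | set u h =>
    refine small_of_injective (β := u) (f := fun y => ⟨y.1.1, ?_⟩) ?_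
    · obtain ⟨y, v, hv, hy⟩ := y
      obtain rfl := (ZFSet.pair_injective hv).2
      exact hy
    · intro a b hab
      exact Subtype.ext (Subtype.ext (by simpa using hab))
  | fn g h1 h2 =>
    rw [IsFn.ext_eq (x := ⟨_, IsThing.fn g h1 h2⟩) ⟨g, rfl⟩]
    infer_instance

/-! ### Sets and functions from small collections. -/

/-- The set with the elements of `S`. -/
noncomputable def mkSet (S : Set Thing) [Small.{0} S] : Thing :=
  ⟨ZFSet.pair ∅ (ZFSet.range fun s : S => s.1.1), .set _ fun y hy => by
    obtain ⟨s, rfl⟩ := ZFSet.mem_range.1 hy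
    exact s.1.2⟩

instance : Nonempty Thing := ⟨mkSet ∅⟩

theorem isSet_mkSet (S : Set Thing) [Small.{0} S] : (mkSet S).IsSet := ⟨_, rfl⟩

theorem ext_mkSet (S : Set Thing) [Small.{0} S] : (mkSet S).ext = S := by
  apply Set.ext
  intro y
  constructor
  · rintro ⟨u, hu, hy⟩
    obtain rfl := (ZFSet.pair_injective hu).2
    obtain ⟨s, hs⟩ := ZFSet.mem_range.1 hy
    obtain rfl : s.1 = y := Subtype.ext hs
    exact s.2
  · exact fun hy => ⟨_, rfl, ZFSet.mem_range.2 ⟨⟨y, hy⟩, rfl⟩⟩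

theorem eq_mkSet_iff {x : Thing} {S : Set Thing} [Small.{0} S] :
    x = mkSet S ↔ x.IsSet ∧ x.ext = S := by
  constructor
  · rintro rfl
    exact ⟨isSet_mkSet S, ext_mkSet S⟩
  · rintro ⟨h, e⟩
    exact h.ext_injective (isSet_mkSet S) (by rw [ext_mkSet, e])

theorem IsSet.nonempty_ext {x : Thing} (hx : x.IsSet) (h : x ≠ mkSet ∅) : x.ext.Nonempty :=
  Set.nonempty_iff_ne_empty.2 fun e => h (eq_mkSet_iff.2 ⟨hx, e⟩)

/-- The function on `S` that sends `a` to `φ a`. -/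
noncomputable def mkFn (S : Set Thing) [Small.{0} S] (φ : Thing → Thing) : Thing :=
  ⟨ZFSet.pair {∅} (ZFSet.range fun s : S => ZFSet.pair s.1.1 (φ s.1).1), .fn _
    (fun a b h => by
      obtain ⟨s, hs⟩ := ZFSet.mem_range.1 h
      exact (ZFSet.pair_injective hs).1 ▸ s.1.2)
    (fun a b h => by
      obtain ⟨s, hs⟩ := ZFSet.mem_range.1 h
      exact (ZFSet.pair_injective hs).2 ▸ (φ s.1).2)⟩

theorem isFn_mkFn (S : Set Thing) [Small.{0} S] (φ : Thing → Thing) : (mkFn S φ).IsFn :=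
  ⟨_, rfl⟩

theorem sends_mkFn {S : Set Thing} [Small.{0} S] {φ : Thing → Thing} {a b : Thing} :
    (mkFn S φ).Sends a b ↔ a ∈ S ∧ b = φ a := by
  constructor
  · rintro ⟨g, hg, h⟩
    obtain rfl := (ZFSet.pair_injective hg).2
    obtain ⟨s, hs⟩ := ZFSet.mem_range.1 h
    obtain ⟨h1, h2⟩ := ZFSet.pair_injective hs
    obtain rfl : s.1 = a := Subtype.ext h1
    exact ⟨s.2, Subtype.ext h2.symm⟩
  · rintro ⟨ha, rfl⟩
    exact ⟨_, rfl, ZFSet.mem_range.2 ⟨⟨a, ha⟩, rfl⟩⟩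

theorem dom_mkFn (S : Set Thing) [Small.{0} S] (φ : Thing → Thing) : (mkFn S φ).dom = S := by
  apply Set.ext
  intro a
  simp [dom, sends_mkFn]

theorem app_mkFn {S : Set Thing} [Small.{0} S] {φ : Thing → Thing} {a : Thing} (h : a ∈ S) :
    (mkFn S φ).app a = φ a :=
  (sends_mkFn.1 (sends_app (by rwa [dom_mkFn]))).2

instance small_dom (f : Thing) : Small.{0} f.dom := by
  rcases f.isSet_or_isFn with h | ⟨g, hg⟩
  · have : f.dom = ∅ := Set.eq_empty_of_forall_notMem fun _ ha => (isFn_of_mem_dom ha).not_isSet h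
    rw [this]
    infer_instance
  -- Each argument is sent to its pair with the chosen value, a member of the graph `g`; its first
  -- component recovers the argument.
  · refine small_of_injective (β := g) (f := fun a => ⟨ZFSet.pair a.1.1 (f.app a.1).1, ?_⟩) ?_
    · obtain ⟨g', hg', h⟩ := sends_app a.2
      obtain rfl := (ZFSet.pair_injective (hg.symm.trans hg')).2
      exact h
    · intro a b hab
      exact Subtype.ext (Subtype.ext (ZFSet.pair_injective (congrArg Subtype.val hab)).1)

/-! ### The primitive relations and constants. -/

/-- `g` is a function on the set `t`. -/
def IsFunOn (t g : Thing) : Prop := g.IsFn ∧ t.IsSet ∧ g.dom = t.ext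

/-- `f : a ↦ b`. -/
def Maps (f a b : Thing) : Prop := a ∈ f.dom ∧ b = f.app a

/-- `f : s ↠ t`. -/
def Surj (f s t : Thing) : Prop := IsFunOn s f ∧ t = mkSet (f.app '' f.dom)

/-- The set `{a}`. -/
noncomputable def single (a : Thing) : Thing := mkSet {a}

/-- The set of all finite Zermelo ordinals. -/
noncomputable def zermelo : Thing := mkSet (Set.range fun n : ℕ => single^[n] (mkSet ∅))

theorem isFunOn_mkFn {t : Thing} (h : t.IsSet) (φ : Thing → Thing) :
    IsFunOn t (mkFn t.ext φ) :=
  ⟨isFn_mkFn _ _, h, dom_mkFn _ _⟩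

theorem ext_single (a : Thing) : (single a).ext = {a} := ext_mkSet _

theorem single_ne_empty (a : Thing) : single a ≠ mkSet ∅ := fun h => by
  have := congrArg ext h
  rw [ext_single, ext_mkSet] at this
  exact Set.singleton_ne_empty a this

end Thing

/-! ### Truth of formulas and the substitution lemma. -/

open Formula

/-- The sequence `a, v 0, v 1, …` in an arbitrary universe. -/
def pushFront {α : Type*} (a : α) (v : ℕ → α) : ℕ → α
  | 0 => a
  | n + 1 => v n

/-- The value of a term. -/
noncomputable def Term.eval (v : ℕ → Thing) (F : ℕ → Thing → Thing) : Term → Thing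
  | var n => v n
  | empty => Thing.mkSet ∅
  | omega => Thing.zermelo
  | inactive => Thing.mkFn ∅ id
  | succ t => Thing.single (t.eval v F)
  | fam k t => F k (t.eval v F)
  | val f t => (f.eval v F).app (t.eval v F)

/-- Truth of a formula in the universe of things. A family variable stands for an arbitrary map
from things to things. -/
def Formula.Sat : Formula → (ℕ → Thing) → (ℕ → Thing → Thing) → Prop
  | eq s t, v, F => s.eval v F = t.eval v F
  | mem s t, v, F => s.eval v F ∈ (t.eval v F).ext
  | surj f s t, v, F => Thing.Surj (f.eval v F) (s.eval v F) (t.eval v F)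
  | maps f s t, v, F => Thing.Maps (f.eval v F) (s.eval v F) (t.eval v F)
  | bot, _, _ => False
  | imp φ ψ, v, F => φ.Sat v F → ψ.Sat v F
  | all φ, v, F => ∀ x, φ.Sat (pushFront x v) F
  | allSet φ, v, F => ∀ x : Thing, x.IsSet → φ.Sat (pushFront x v) F
  | allFun t φ, v, F => ∀ g, Thing.IsFunOn (t.eval v F) g → φ.Sat (pushFront g v) F
  | allFam t φ, v, F => ∀ G : Thing → Thing,
      (∀ ξ ∈ (t.eval v F).ext, Thing.IsFunOn (Thing.single ξ) (G ξ)) → φ.Sat v (pushFront G F)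
  | bigAnd t f k, v, F => ∀ ξ ∈ (t.eval v F).ext,
      Thing.Maps (f.eval v F) ξ ((F k ξ).app ξ)

theorem Term.eval_subst (t : Term) (σ : ℕ → Term) (ρ : ℕ → ℕ) (v : ℕ → Thing)
    (F : ℕ → Thing → Thing) :
    (t.subst σ ρ).eval v F = t.eval (fun n => (σ n).eval v F) (fun k => F (ρ k)) := by
  induction t <;> simp_all [Term.subst, Term.eval]

@[simp] theorem Term.eval_shift (t : Term) (x : Thing) (v : ℕ → Thing) (F : ℕ → Thing → Thing) :
    t.shift.eval (pushFront x v) F = t.eval v F :=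
  t.eval_subst _ _ _ _

@[simp] theorem Term.eval_shiftFam (t : Term) (G : Thing → Thing) (v : ℕ → Thing)
    (F : ℕ → Thing → Thing) : t.shiftFam.eval v (pushFront G F) = t.eval v F :=
  t.eval_subst _ _ _ _

theorem eval_up (σ : ℕ → Term) (x : Thing) (v : ℕ → Thing) (F : ℕ → Thing → Thing) :
    (fun n => (up σ n).eval (pushFront x v) F) = pushFront x fun n => (σ n).eval v F := by
  funext n
  cases n with
  | zero => rfl
  | succ n => exact (σ n).eval_shift x v F

theorem pushFront_upFam (ρ : ℕ → ℕ) (G : Thing → Thing) (F : ℕ → Thing → Thing) :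
    (fun k => pushFront G F (upFam ρ k)) = pushFront G fun k => F (ρ k) := by
  funext k
  cases k <;> rfl

theorem eval_scons (t : Term) (σ : ℕ → Term) (v : ℕ → Thing) (F : ℕ → Thing → Thing) :
    (fun n => (scons t σ n).eval v F) = pushFront (t.eval v F) fun n => (σ n).eval v F := by
  funext n
  cases n <;> rfl

namespace Formula

/-- The substitution lemma: substituting in the formula amounts to changing the assignment. The
variable conditions in the quantifier rules reduce to its special cases for shifting and
instantiation. -/
theorem sat_subst (φ : Formula) : ∀ (σ : ℕ → Term) (ρ : ℕ → ℕ) (v : ℕ → Thing)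
    (F : ℕ → Thing → Thing), (φ.subst σ ρ).Sat v F ↔
      φ.Sat (fun n => (σ n).eval v F) (fun k => F (ρ k)) := by
  induction φ <;> intro σ ρ v F <;>
    simp_all [Formula.subst, Sat, Term.eval_subst, eval_up, pushFront_upFam]

@[simp] theorem sat_shift (φ : Formula) (x : Thing) (v : ℕ → Thing) (F : ℕ → Thing → Thing) :
    φ.shift.Sat (pushFront x v) F ↔ φ.Sat v F :=
  φ.sat_subst _ _ _ _

@[simp] theorem sat_shiftFam (φ : Formula) (G : Thing → Thing) (v : ℕ → Thing)
    (F : ℕ → Thing → Thing) : φ.shiftFam.Sat v (pushFront G F) ↔ φ.Sat v F :=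
  φ.sat_subst _ _ _ _

@[simp] theorem sat_inst (φ : Formula) (t : Term) (v : ℕ → Thing) (F : ℕ → Thing → Thing) :
    (φ.inst t).Sat v F ↔ φ.Sat (pushFront (t.eval v F) v) F := by
  rw [inst, sat_subst, eval_scons]
  rfl

@[simp] theorem sat_instFam (φ : Formula) (k : ℕ) (v : ℕ → Thing) (F : ℕ → Thing → Thing) :
    (φ.instFam k).Sat v F ↔ φ.Sat v (pushFront (F k) F) := by
  have : (fun n => F (scons k id n)) = pushFront (F k) F := by
    funext n
    cases n <;> rfl
  rw [instFam, sat_subst, this]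
  rfl

section Connectives

variable (φ ψ : Formula) (t : Term) (v : ℕ → Thing) (F : ℕ → Thing → Thing)

@[simp] theorem sat_neg : φ.neg.Sat v F ↔ ¬ φ.Sat v F := Iff.rfl

@[simp] theorem sat_and : (φ.and ψ).Sat v F ↔ φ.Sat v F ∧ ψ.Sat v F := by
  simp [Formula.and, Sat]

@[simp] theorem sat_or : (φ.or ψ).Sat v F ↔ φ.Sat v F ∨ ψ.Sat v F := by
  simp [Formula.or, Sat, or_iff_not_imp_left]

@[simp] theorem sat_iff : (φ.iff ψ).Sat v F ↔ (φ.Sat v F ↔ ψ.Sat v F) := by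
  simp [Formula.iff, Sat, iff_iff_implies_and_implies]

@[simp] theorem sat_ex : (ex φ).Sat v F ↔ ∃ x, φ.Sat (pushFront x v) F := by
  simp [ex, Sat]

@[simp] theorem sat_exSet :
    (exSet φ).Sat v F ↔ ∃ x : Thing, x.IsSet ∧ φ.Sat (pushFront x v) F := by
  simp [exSet, Sat]

@[simp] theorem sat_exFun : (exFun t φ).Sat v F ↔
    ∃ g, Thing.IsFunOn (t.eval v F) g ∧ φ.Sat (pushFront g v) F := by
  simp [exFun, Sat]

@[simp] theorem sat_exFam : (exFam t φ).Sat v F ↔ ∃ G : Thing → Thing,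
    (∀ ξ ∈ (t.eval v F).ext, Thing.IsFunOn (Thing.single ξ) (G ξ)) ∧
      φ.Sat v (pushFront G F) := by
  simp [exFam, Sat]

@[simp] theorem sat_exUnique : (exUnique φ).Sat v F ↔ ∃! x, φ.Sat (pushFront x v) F := by
  simp only [exUnique, sat_ex, sat_and, Sat, sat_subst, eval_scons]
  rfl

@[simp] theorem sat_allIn :
    (allIn t φ).Sat v F ↔ ∀ x ∈ (t.eval v F).ext, φ.Sat (pushFront x v) F := by
  simp [allIn, Sat, Term.eval, pushFront]

@[simp] theorem sat_exIn :
    (exIn t φ).Sat v F ↔ ∃ x ∈ (t.eval v F).ext, φ.Sat (pushFront x v) F := by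
  simp [exIn, Sat, Term.eval, pushFront]

@[simp] theorem sat_isSet : (isSet t).Sat v F ↔ (t.eval v F).IsSet := by
  simp [isSet, Sat, Term.eval, pushFront]

@[simp] theorem sat_isFun (g : Term) :
    (isFun t g).Sat v F ↔ Thing.IsFunOn (t.eval v F) (g.eval v F) := by
  simp [isFun, Sat, Term.eval, pushFront]

@[simp] theorem sat_isFam (k : ℕ) : (isFam t k).Sat v F ↔
    ∀ ξ ∈ (t.eval v F).ext, Thing.IsFunOn (Thing.single ξ) (F k ξ) := by
  simp [isFam, Term.eval, pushFront]

end Connectives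

end Formula

/-! ### Soundness. -/

/-- Soundness of the calculus: what is derivable from formulas that are true in the universe of
things is true there. -/
theorem Derives.sat {T : Set Formula} (hT : ∀ φ ∈ T, ∀ v F, φ.Sat v F) {Γ : List Formula}
    {φ : Formula} (h : Derives T Γ φ) :
    ∀ v F, (∀ γ ∈ Γ, γ.Sat v F) → φ.Sat v F := by
  induction h with
  | ax h => exact fun v F _ => hT _ h v F
  | hyp h => exact fun v F hΓ => hΓ _ h
  | impI _ ih => exact fun v F hΓ hφ => ih v F (List.forall_mem_cons.2 ⟨hφ, hΓ⟩)
  | impE _ _ ih1 ih2 => exact fun v F hΓ => ih1 v F hΓ (ih2 v F hΓ)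
  | raa _ ih => exact fun v F hΓ => by_contra fun hφ => ih v F (List.forall_mem_cons.2 ⟨hφ, hΓ⟩)
  | eqI t => exact fun v F _ => rfl
  | eqE φ s t _ _ ih1 ih2 =>
    intro v F hΓ
    have h1 : s.eval v F = t.eval v F := ih1 v F hΓ
    have h2 := ih2 v F hΓ
    rw [sat_inst] at h2 ⊢
    rwa [← h1]
  | allI _ ih => exact fun v F hΓ x => ih _ F (by simpa using hΓ)
  | allE t _ ih => exact fun v F hΓ => (sat_inst _ _ _ _).2 (ih v F hΓ _)
  | allSetI _ ih =>
    exact fun v F hΓ x hx => ih _ F (by simpa [Term.eval, pushFront] using ⟨hx, hΓ⟩)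
  | allSetE t _ _ ih1 ih2 =>
    exact fun v F hΓ => (sat_inst _ _ _ _).2 (ih1 v F hΓ _ ((sat_isSet _ _ _).1 (ih2 v F hΓ)))
  | allFunI _ ih =>
    exact fun v F hΓ x hx => ih _ F (by simpa [Term.eval, pushFront] using ⟨hx, hΓ⟩)
  | allFunE g _ _ ih1 ih2 =>
    exact fun v F hΓ => (sat_inst _ _ _ _).2 (ih1 v F hΓ _ ((sat_isFun _ _ _ _).1 (ih2 v F hΓ)))
  | thing t =>
    intro v F _
    simp only [sat_or, sat_isSet, sat_exSet, sat_isFun, Term.eval_shift]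
    refine (t.eval v F).isSet_or_isFn.imp_right fun h => ?_
    -- A function is a function on the set of its arguments, which exists because domains are small.
    exact ⟨_, Thing.isSet_mkSet (t.eval v F).dom, h, Thing.isSet_mkSet _, (Thing.ext_mkSet _).symm⟩
  | valI f t _ ih =>
    intro v F hΓ
    have h := ih v F hΓ
    simp only [sat_exUnique, Sat, Term.eval_shift] at h
    -- Any witness puts the argument in the domain, and there `Maps` relates it to the `app` value
    -- by definition.
    obtain ⟨b, hb, -⟩ := h
    exact ⟨hb.1, rfl⟩
  | allFamI _ ih =>
    exact fun v F hΓ G hG => ih v _ (by simpa [pushFront] using ⟨hG, hΓ⟩)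
  | allFamE k _ _ ih1 ih2 =>
    exact fun v F hΓ => (sat_instFam _ _ _ _).2 (ih1 v F hΓ _ ((sat_isFam _ _ _ _).1 (ih2 v F hΓ)))
  | exFamI t φ _ ih =>
    intro v F hΓ
    have h := ih v F hΓ
    simp only [sat_allIn, sat_exFun] at h
    -- Families are total maps, so the choice is extended outside the index set by a default value,
    -- `ξ` itself.
    have h' : ∀ ξ, ∃ g, ξ ∈ (t.eval v F).ext → Thing.IsFunOn (Thing.single ξ) g ∧
        φ.Sat (pushFront g (pushFront ξ v)) F := fun ξ => by
      by_cases hξ : ξ ∈ (t.eval v F).ext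
      · obtain ⟨g, hg⟩ := h ξ hξ
        exact ⟨g, fun _ => hg⟩
      · exact ⟨ξ, fun h => (hξ h).elim⟩
    choose G hG using h'
    rw [sat_exFam]
    refine ⟨G, fun ξ hξ => (hG ξ hξ).1, ?_⟩
    simp only [sat_allIn, Term.eval_shiftFam, sat_subst, eval_scons]
    exact fun ξ hξ => (hG ξ hξ).2
  | bigAndI t f k _ ih =>
    intro v F hΓ ξ hξ
    have h := ih (pushFront ξ v) F (by simpa [Sat, Term.eval, pushFront] using ⟨hξ, hΓ⟩)
    simpa [Sat, Term.eval, pushFront] using h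
  | bigAndE t f k s _ _ ih1 ih2 =>
    exact fun v F hΓ => ih1 v F hΓ _ (ih2 v F hΓ)

/-! ### Truth of the postulates. -/

open Formula Thing

/-- `φ` is true in the universe of things, for all values of its free variables. -/
def Valid (φ : Formula) : Prop := ∀ v F, φ.Sat v F

theorem valid_extensionality : Valid extensionality := by
  intro v F
  simp only [extensionality, Sat, sat_iff, Term.eval, pushFront]
  exact fun x hx y hy => ⟨fun h _ => h ▸ Iff.rfl, fun h => hx.ext_injective hy (Set.ext h)⟩

theorem valid_functionsNotSets : Valid functionsNotSets := by
  intro v F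
  simp only [functionsNotSets, Sat, sat_neg, Term.eval, pushFront]
  rintro x - f hf y hy rfl
  exact hf.1.not_isSet hy

theorem valid_setsInactive : Valid setsInactive := by
  intro v F
  simp only [setsInactive, Sat, sat_and, sat_neg, Term.eval, pushFront]
  exact fun x hx a b => ⟨fun h => h.1.1.not_isSet hx, fun h => (isFn_of_mem_dom h.1).not_isSet hx⟩

theorem valid_emptySet : Valid emptySet := by
  intro v F
  simp only [emptySet, Sat, sat_and, sat_neg, sat_exSet, Term.eval, pushFront]
  exact ⟨_, isSet_mkSet ∅, rfl, by simp [ext_mkSet]⟩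

theorem valid_pairing : Valid pairing := by
  intro v F
  simp only [pairing, Sat, sat_iff, sat_or, sat_exSet, Term.eval, pushFront]
  exact fun a b => ⟨_, isSet_mkSet {a, b}, by simp [ext_mkSet]⟩

theorem valid_unionSet : Valid unionSet := by
  intro v F
  simp only [unionSet, Sat, sat_and, sat_iff, sat_exSet, Term.eval, pushFront]
  refine fun x hx => ⟨_, isSet_mkSet (⋃ z : x.ext, z.1.ext), fun a => ?_⟩
  simp only [ext_mkSet, Set.mem_iUnion, Subtype.exists, exists_prop]
  exact exists_congr fun z => ⟨fun h => ⟨isSet_of_mem h.2, h⟩, fun h => h.2⟩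

theorem valid_powerSet : Valid powerSet := by
  intro v F
  simp only [powerSet, Sat, sat_and, sat_iff, sat_exSet, sat_allIn, Term.eval, pushFront]
  intro x hx
  -- Indexing by Lean subsets of the small type `x.ext` makes the collection of subsets visibly
  -- small.
  refine ⟨_, isSet_mkSet (Set.range fun s : Set x.ext => mkSet (Subtype.val '' s)), fun a => ?_⟩
  rw [ext_mkSet, Set.mem_range]
  constructor
  · rintro ⟨s, rfl⟩
    refine ⟨_, isSet_mkSet _, ?_, rfl⟩
    rw [ext_mkSet]
    rintro _ ⟨y, -, rfl⟩
    exact y.2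
  · rintro ⟨_, hz, h, rfl⟩
    refine ⟨Subtype.val ⁻¹' a.ext, (eq_mkSet_iff.2 ⟨hz, ?_⟩).symm⟩
    rw [Subtype.image_preimage_coe]
    exact (Set.inter_eq_right.2 h).symm

theorem valid_regularity : Valid regularity := by
  intro v F
  simp only [regularity, Sat, sat_and, sat_neg, sat_ex, Term.eval, pushFront]
  exact fun x hx h => exists_minimal_mem (hx.nonempty_ext h)

theorem valid_infiniteSet : Valid infiniteSet := by
  intro v F
  simp only [infiniteSet, Sat, sat_and, sat_neg, sat_iff, sat_exSet, sat_allIn, sat_exIn,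
    Term.eval, pushFront]
  have hmem : ∀ a, a ∈ zermelo.ext ↔ ∃ n : ℕ, single^[n] (mkSet ∅) = a := fun a => by
    rw [zermelo, ext_mkSet, Set.mem_range]
  refine ⟨_, isSet_mkSet _, rfl, (hmem _).2 ⟨0, rfl⟩, ?_, ?_⟩
  · intro a ha
    obtain ⟨n, rfl⟩ := (hmem a).1 ha
    exact (hmem _).2 ⟨n + 1, Function.iterate_succ_apply' _ _ _⟩
  · intro a ha
    obtain ⟨n, rfl⟩ := (hmem a).1 ha
    constructor
    · intro h
      cases n with
      | zero => rfl
      | succ n =>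
        exact (h ⟨_, (hmem _).2 ⟨n, rfl⟩, Function.iterate_succ_apply' _ _ _⟩).elim
    · rintro h ⟨b, -, hb⟩
      exact single_ne_empty b (hb.symm.trans h)

theorem valid_successor : Valid successor := by
  intro v F
  simp only [successor, Sat, sat_and, sat_iff, sat_exSet, Term.eval, pushFront]
  intro a b
  rw [single, eq_mkSet_iff]
  constructor
  · rintro ⟨h, e⟩
    exact ⟨b, h, rfl, by simp [e]⟩
  · rintro ⟨_, h, rfl, e⟩
    exact ⟨h, Set.ext e⟩

theorem valid_functionsNoElements : Valid functionsNoElements := by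
  intro v F
  simp only [functionsNoElements, Sat, sat_neg, Term.eval, pushFront]
  exact fun x _ f hf a ha => hf.1.not_isSet (isSet_of_mem ha)

theorem valid_functionsAct : Valid functionsAct := by
  intro v F
  simp only [functionsAct, Sat, sat_neg, sat_and, sat_exSet, sat_allIn, sat_exUnique, Term.eval,
    pushFront]
  refine fun x hx f hf _ => ⟨x, hx, _, isSet_mkSet _, ⟨hf, rfl⟩, fun a ha => ?_⟩
  exact ⟨f.app a, ⟨hf.2.2 ▸ ha, rfl⟩, fun b hb => hb.2⟩

/-- A set on which `f` is a function has extension `f.dom`, so extensionality leaves only one. -/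
theorem valid_uniqueDomain : Valid uniqueDomain := by
  intro v F
  simp only [uniqueDomain, Sat, sat_neg, Term.eval, pushFront]
  exact fun x hx f hf a ha b h => ha (h.1.2.1.ext_injective hx (h.1.2.2.symm.trans hf.2.2))

theorem valid_noActionOutside : Valid noActionOutside := by
  intro v F
  simp only [noActionOutside, Sat, sat_neg, Term.eval, pushFront]
  exact fun x hx f hf a ha b h => ha (hf.2.2 ▸ h.1)

theorem valid_imageSet : Valid imageSet := by
  intro v F
  simp only [imageSet, Sat, sat_neg, sat_and, sat_iff, sat_exSet, sat_exIn, Term.eval, pushFront]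
  rintro x hx f hf - _ ⟨-, rfl⟩
  refine ⟨_, isSet_mkSet _, rfl, fun b => ?_⟩
  rw [ext_mkSet, hf.2.2]
  exact exists_congr fun a => and_congr_right fun ha =>
    ⟨fun h => ⟨hf.2.2 ▸ ha, h.symm⟩, fun h => h.2.symm⟩

/-- Separation holds in the universe of things, for an arbitrary property. -/
theorem exists_isSet_sep (x : Thing) (p : Thing → Prop) :
    ∃ y : Thing, y.IsSet ∧ ∀ a, a ∈ y.ext ↔ a ∈ x.ext ∧ p a := by
  have : Small.{0} {a | a ∈ x.ext ∧ p a} := small_subset fun _ h => And.left h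
  exact ⟨_, isSet_mkSet {a | a ∈ x.ext ∧ p a}, fun a => by rw [ext_mkSet]; rfl⟩

theorem valid_inverseImageSet : Valid inverseImageSet := by
  intro v F
  simp only [inverseImageSet, Sat, sat_neg, sat_and, sat_iff, sat_exSet, Term.eval, pushFront]
  exact fun x _ _ f _ _ _ _ b => exists_isSet_sep x fun a => f.Maps a b

theorem valid_inactiveFunction : Valid inactiveFunction := by
  intro v F
  simp only [inactiveFunction, Sat, sat_neg, sat_and, sat_exFun, Term.eval, pushFront]
  have h : IsFunOn (mkSet ∅) (mkFn ∅ id) :=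
    ⟨isFn_mkFn _ _, isSet_mkSet _, by rw [dom_mkFn, ext_mkSet]⟩
  refine ⟨_, h, rfl, ⟨h, ?_⟩, fun a b hab => ?_⟩
  · exact eq_mkSet_iff.2 ⟨isSet_mkSet _, by rw [ext_mkSet, dom_mkFn, Set.image_empty]⟩
  · have := hab.1
    rw [dom_mkFn] at this
    exact this

theorem valid_urFunction : Valid urFunction := by
  intro v F
  simp only [urFunction, Sat, sat_and, sat_exFun, Term.eval, pushFront]
  intro a b
  have h : IsFunOn (single a) (mkFn (single a).ext fun _ => b) := isFunOn_mkFn (isSet_mkSet _) _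
  have ha : a ∈ (single a).ext := by rw [ext_single]; rfl
  have e : (mkFn (single a).ext fun _ => b).app a = b := app_mkFn (φ := fun _ => b) ha
  -- From here on only the domain of this function and its value at `a` matter.
  generalize mkFn (single a).ext (fun _ => b) = f at h e
  refine ⟨f, h, ⟨h, eq_mkSet_iff.2 ⟨isSet_mkSet _, ?_⟩⟩, h.2.2 ▸ ha, e.symm⟩
  rw [h.2.2, ext_single, ext_single, Set.image_singleton, e]

theorem valid_functionRegularity : Valid functionRegularity := by
  intro v F
  simp only [functionRegularity, Sat, sat_neg, sat_and, Term.eval, pushFront]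
  exact fun _ _ f _ _ _ _ a =>
    ⟨fun h => notMem_dom_self f h.1, fun h => app_ne_self h.1 h.2.symm⟩

theorem valid_separation (φ : Formula) : Valid (separation φ) := by
  intro v F
  simp only [separation, Sat, sat_and, sat_iff, sat_exSet, Term.eval, pushFront, sat_subst,
    eval_scons]
  exact fun x _ => exists_isSet_sep x fun a => φ.Sat (pushFront a (pushFront x v)) F

/-- Truth of `ψ` is a Lean relation, so the unique values define a Lean map, and the image of a
small extension is small. -/
theorem valid_replacement (ψ : Formula) : Valid (replacement ψ) := by
  intro v F
  simp only [replacement, Sat, sat_iff, sat_exSet, sat_allIn, sat_exIn, sat_exUnique,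
    Term.eval, pushFront, sat_subst, eval_scons]
  intro x _ h
  choose! g hg hg' using h
  refine ⟨_, isSet_mkSet (g '' x.ext), fun b => ?_⟩
  rw [ext_mkSet]
  refine exists_congr fun a => and_congr_right fun ha => ?_
  exact ⟨fun e => e ▸ hg a ha, fun h => (hg' a ha b h).symm⟩

/-! ### Two-tuples, reverse graph and sum functions. -/

namespace Thing

/-- `t` is the set `{a, b}`. -/
def IsPairSet (t a b : Thing) : Prop := t.IsSet ∧ ∀ c, c ∈ t.ext ↔ c = a ∨ c = b

/-- `t` is the two-tuple `{a, {a, b}}`. -/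
def IsTuple (t a b : Thing) : Prop := ∃ p, IsPairSet p a b ∧ IsPairSet t a p

theorem IsPairSet.right_eq {t a b c : Thing} (h : IsPairSet t a b) (h' : IsPairSet t a c) :
    b = c := by
  have h1 := (h'.2 b).1 ((h.2 b).2 (Or.inr rfl))
  have h2 := (h.2 c).1 ((h'.2 c).2 (Or.inr rfl))
  aesop

/-- For the tuple `{a, {a, b}}` the first component is determined only thanks to regularity: if `a ≠
c`, then `a = {c, d}` and `c = {a, b}`, giving the cycle `c ∈ a ∈ c`, which ranks exclude. -/
theorem IsTuple.injective {t a b c d : Thing} (h : IsTuple t a b) (h' : IsTuple t c d) :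
    a = c ∧ b = d := by
  obtain ⟨p, hp, ht⟩ := h
  obtain ⟨q, hq, ht'⟩ := h'
  have hac : a = c := by
    by_contra hne
    have h1 : a = q := ((ht'.2 a).1 ((ht.2 a).2 (Or.inl rfl))).resolve_left hne
    have h2 : c = p := ((ht.2 c).1 ((ht'.2 c).2 (Or.inl rfl))).resolve_left (Ne.symm hne)
    have h3 := rank_lt_of_mem_ext ((hq.2 c).2 (Or.inl rfl))
    have h4 := rank_lt_of_mem_ext ((hp.2 a).2 (Or.inl rfl))
    rw [← h1] at h3
    rw [← h2] at h4
    exact lt_asymm h3 h4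
  subst hac
  obtain rfl := ht.right_eq ht'
  exact ⟨rfl, hp.right_eq hq⟩

end Thing

@[simp] theorem sat_isTuple (t a b : Term) (v : ℕ → Thing) (F : ℕ → Thing → Thing) :
    (isTuple t a b).Sat v F ↔ (t.eval v F).IsTuple (a.eval v F) (b.eval v F) := by
  simp [isTuple, isPairSet, IsTuple, IsPairSet, Sat, Term.eval, pushFront]

@[simp] theorem sat_tupleMem (a b g : Term) (v : ℕ → Thing) (F : ℕ → Thing → Thing) :
    (tupleMem a b g).Sat v F ↔
      ∃ t ∈ (g.eval v F).ext, t.IsTuple (a.eval v F) (b.eval v F) := by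
  simp [tupleMem, Term.eval, pushFront]

theorem valid_reverseGraph : Valid reverseGraph := by
  intro v F
  simp only [reverseGraph, isGraph, Sat, sat_and, sat_iff, sat_isSet, sat_exFun, sat_allIn,
    sat_exIn, sat_exUnique, sat_isTuple, sat_tupleMem, Term.eval_shift, Term.eval, pushFront]
  rintro g - x hx y - ⟨-, hg, hfun⟩
  choose! φ hφ hφ' using hfun
  refine ⟨_, isFunOn_mkFn hx φ, fun a b => ?_⟩
  rw [Maps, dom_mkFn]
  constructor
  · rintro ⟨ha, hb⟩
    rw [app_mkFn ha] at hb
    exact hb ▸ hφ a ha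
  · rintro ⟨t, ht, htab⟩
    -- Members of the graph have first component in the domain; by injectivity of tuples that
    -- component is `a`, and uniqueness of values gives `b = φ a`.
    obtain ⟨c, hc, d, -, htcd⟩ := hg t ht
    obtain rfl := (htab.injective htcd).1
    exact ⟨hc, by rw [app_mkFn hc]; exact hφ' a hc b ⟨t, ht, htab⟩⟩

/-- The index set has a small extension, so the diagonal map `ξ ↦ (G ξ).app ξ` restricted to it is a
function of the universe, even though `G` is an arbitrary map on all things. Its image set serves as
`Y`. -/
theorem valid_sumF : Valid sumF := by
  intro v F
  simp only [sumF, Sat, sat_and, sat_exFun, sat_exSet, Term.eval, pushFront]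
  intro x hx G _
  have h := isFunOn_mkFn hx fun ξ => (G ξ).app ξ
  refine ⟨_, h, _, isSet_mkSet _, ⟨h, rfl⟩, fun ξ hξ => ⟨?_, (app_mkFn (φ := fun ξ => (G ξ).app ξ) hξ).symm⟩⟩
  rwa [dom_mkFn]

/-! ### Underivability and consistency. -/

theorem valid_of_mem_basicPostulates {φ : Formula} (h : φ ∈ basicPostulates) : Valid φ := by
  rcases h with rfl | rfl | rfl | rfl | rfl | rfl | rfl | rfl | rfl | rfl | rfl | rfl | rfl | rfl |
    rfl | rfl | rfl | rfl | rfl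
  exacts [valid_extensionality, valid_functionsNotSets, valid_setsInactive, valid_emptySet,
    valid_pairing, valid_unionSet, valid_powerSet, valid_regularity, valid_infiniteSet,
    valid_successor, valid_functionsNoElements, valid_functionsAct, valid_uniqueDomain,
    valid_noActionOutside, valid_imageSet, valid_inverseImageSet, valid_inactiveFunction,
    valid_urFunction, valid_functionRegularity]

theorem valid_of_mem_theoryT0 {φ : Formula} (h : φ ∈ theoryT0) : Valid φ := by
  rcases h with ((h | ⟨φ, -, rfl⟩) | ⟨ψ, -, rfl⟩) | rfl
  exacts [valid_of_mem_basicPostulates h, valid_separation φ, valid_replacement ψ,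
    valid_reverseGraph]

theorem Entails.valid {T : Set Formula} (hT : ∀ φ ∈ T, Valid φ) {φ : Formula}
    (h : Entails T φ) : Valid φ :=
  fun v F => Derives.sat hT h v F (by simp)

theorem consistent_of_valid {T : Set Formula} (hT : ∀ φ ∈ T, Valid φ) : Consistent T :=
  -- The assignment is an arbitrary one: `bot` is false under all of them.
  fun h => Entails.valid hT h (fun _ => mkSet ∅) fun _ => id

end FunSet

theorem mainTheorem4 :
    ¬ FunSet.Entails FunSet.theoryT0 FunSet.sumF.neg ∧
    (FunSet.Consistent FunSet.theoryT0 →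
      FunSet.Consistent (FunSet.theoryT0 ∪ {FunSet.sumF}) ∧
      FunSet.Consistent FunSet.theoryT) := by
  refine ⟨fun h => ?_, fun _ => ⟨FunSet.consistent_of_valid ?_, FunSet.consistent_of_valid ?_⟩⟩
  · exact FunSet.Entails.valid (fun _ => FunSet.valid_of_mem_theoryT0) h
      (fun _ => FunSet.Thing.mkSet ∅) (fun _ => id) (FunSet.valid_sumF _ _)
  · rintro φ (h | rfl)
    exacts [FunSet.valid_of_mem_theoryT0 h, FunSet.valid_sumF]
  · rintro φ (h | rfl)
    exacts [FunSet.valid_of_mem_basicPostulates h, FunSet.valid_sumF]
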